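/- For a finite group $G$, a stem extension of $G$ is a surjective group homomorphism $\pi\colon E\to G$ with $\ker\pi\subseteq Z(E)\cap E'$, where $E'$ is the derived subgroup, and a Schur cover of $G$ is a stem extension with $|E|$ maximal. Given a Schur cover $\pi\colon\tilde G\to G$, the deep commuting graph $\Delta_D(G)$ is the simple graph with vertex set $G$ in which two distinct elements are adjacent if and only if their preimages under $\pi$ commute in $\tilde G$. The enhanced power graph $\mathcal P_e(G)$ is the simple graph with vertex set $G$ in which two distinct elements $x,y$ are adjacent if and only if $\langle x,y\rangle$ is cyclic. Theorem. Every finite abelian group has a Schur cover, and the following hold, whichever Schur cover is used to form $\Delta_D$. (i) Let $p$ be a prime and let $G$ be a finite non-cyclic abelian $p$-group. Then $\Delta_D(G)=\mathcal P_e(G)$ if and only if $G$ is elementary abelian (that is, $x^p=1$ for all $x\in G$). (ii) Let $A$ be a finite abelian group. Then $\Delta_D(A)=\mathcal P_e(A)$ if and only if, for every prime $p$, the Sylow $p$-subgroup of $A$ is cyclic or elementary abelian. -/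

import Mathlib

/-!
Every stem extension `E` of an abelian group `A` has class at most two, so its commutator induces a
homomorphism from the exterior square `Λ²A` onto the kernel, and `|E| ≤ |A| |Λ²A|`. The bound is
attained: as `A` is a direct sum of cyclic groups, keeping the upper triangle of the universal
alternating form `∧` gives a bilinear `β` with `β x y - β y x = x ∧ y`, and the central extension of
`A` by `Λ²A` with cocycle `β` is a stem extension. Hence in every Schur cover the commutator map
`Λ²A → E` is injective, the preimages of `x` and `y` commute if and only if `x ∧ y = 0`, and the two
graphs agree if and only if `x ∧ y = 0` forces `⟨x, y⟩` to be cyclic.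

This last condition can be tested on the Sylow subgroups. In a `p`-group in which `w ^ p ≠ 1` and
`w ^ (p * p) = 1`, one has `w ^ p ∧ v = 0` for every `v` with `v ^ p = 1`, so the condition puts all
such `v` into `⟨w ^ p⟩` and the group is cyclic. In an elementary abelian `p`-group, `x ∧ y = 0`
says that `x` and `y` are linearly dependent over `ZMod p`.
-/

universe u

/-- `π : E →* G` is a stem extension of `G`: it is onto, and its kernel is contained in both the
centre and the derived subgroup of `E`. -/
structure IsStemExtension {G E : Type u} [Group G] [Group E] (π : E →* G) : Prop where
  surjective : Function.Surjective π
  ker_le_center : π.ker ≤ Subgroup.center E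
  ker_le_commutator : π.ker ≤ commutator E

/-- `π : E →* G` is a Schur cover of the finite group `G`: a stem extension of maximal order.
(All stem extensions of a finite group are finite.) -/
structure IsSchurCover {G E : Type u} [Group G] [Group E] (π : E →* G) : Prop where
  stem : IsStemExtension π
  finite : Finite E
  maximal : ∀ (F : Type u) [Group F] [Finite F] (ρ : F →* G),
    IsStemExtension ρ → Nat.card F ≤ Nat.card E

/-- The deep commuting graph of `G`, computed in the Schur cover `π : E →* G`: distinct elements
of `G` are adjacent when their preimages in `E` commute. -/
def deepCommutingGraph {G E : Type u} [Group G] [Group E] (π : E →* G) : SimpleGraph G where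
  Adj x y := x ≠ y ∧ ∀ a b : E, π a = x → π b = y → Commute a b
  symm := ⟨fun _ _ h => ⟨h.1.symm, fun a b ha hb => (h.2 b a hb ha).symm⟩⟩
  loopless := ⟨fun _ h => h.1 rfl⟩

/-- The enhanced power graph of `G`: distinct `x`, `y` are adjacent when `⟨x, y⟩` is cyclic. -/
def enhancedPowerGraph (G : Type u) [Group G] : SimpleGraph G where
  Adj x y := x ≠ y ∧ IsCyclic (Subgroup.closure ({x, y} : Set G))
  symm := ⟨fun x y h => ⟨h.1.symm, by rw [Set.pair_comm]; exact h.2⟩⟩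
  loopless := ⟨fun _ h => h.1 rfl⟩

/-- `G` is an elementary abelian `p`-group. -/
def IsElementaryAbelian (p : ℕ) (G : Type u) [Group G] : Prop :=
  (∀ x y : G, x * y = y * x) ∧ ∀ x : G, x ^ p = 1

open scoped commutatorElement IsMulCommutative

noncomputable section ExteriorSquare

variable {R M N : Type*} [CommRing R] [AddCommGroup M] [Module R M] [AddCommGroup N] [Module R N]

variable (R) in
/-- The universal alternating bilinear map `(x, y) ↦ x ∧ y` of a module into its exterior square. -/
def wedge : M →ₗ[R] M →ₗ[R] ⋀[R]^2 M :=
  LinearMap.mk₂ R (fun x y => exteriorPower.ιMulti R 2 ![x, y])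
    (fun x x' y => Subtype.ext <| by simp [ExteriorAlgebra.ιMulti_apply, add_mul])
    (fun c x y => Subtype.ext <| by simp [ExteriorAlgebra.ιMulti_apply])
    (fun x y y' => Subtype.ext <| by simp [ExteriorAlgebra.ιMulti_apply, mul_add])
    (fun c x y => Subtype.ext <| by simp [ExteriorAlgebra.ιMulti_apply])

theorem wedge_isAlt : (wedge R : M →ₗ[R] M →ₗ[R] ⋀[R]^2 M).IsAlt := fun x =>
  (exteriorPower.ιMulti R 2).map_eq_zero_of_eq ![x, x] (i := 0) (j := 1) rfl (by decide)

theorem map_wedge (f : M →ₗ[R] N) (x y : M) :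
    exteriorPower.map 2 f (wedge R x y) = wedge R (f x) (f y) :=
  (exteriorPower.map_apply_ιMulti f ![x, y]).trans <|
    congrArg (exteriorPower.ιMulti R 2) (List.ofFn_inj.1 rfl)

theorem span_range_wedge :
    Submodule.span R (Set.range fun x : M × M => wedge R x.1 x.2) = ⊤ := by
  rw [eq_top_iff, ← exteriorPower.ιMulti_span R 2 M]
  refine Submodule.span_mono ?_
  rintro _ ⟨v, rfl⟩
  exact ⟨(v 0, v 1), congrArg (exteriorPower.ιMulti R 2) (List.ofFn_inj.1 rfl)⟩

/-- An alternating bilinear map, as an alternating map in a family of two variables. -/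
def alternatingMapOfIsAlt (ω : M →ₗ[R] M →ₗ[R] N) (hω : ω.IsAlt) : M [⋀^Fin 2]→ₗ[R] N where
  toFun v := ω (v 0) (v 1)
  map_update_add' v i x y := by fin_cases i <;> simp
  map_update_smul' v i c x := by fin_cases i <;> simp
  map_eq_zero_of_eq' v i j hv hij := by
    have h : v 0 = v 1 := by fin_cases i <;> fin_cases j <;> simp_all
    rw [h, hω]

/-- The linear map on the exterior square induced by an alternating bilinear map. -/
def wedgeLift (ω : M →ₗ[R] M →ₗ[R] N) (hω : ω.IsAlt) : ⋀[R]^2 M →ₗ[R] N :=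
  exteriorPower.alternatingMapLinearEquiv (alternatingMapOfIsAlt ω hω)

@[simp]
theorem wedgeLift_wedge (ω : M →ₗ[R] M →ₗ[R] N) (hω : ω.IsAlt) (x y : M) :
    wedgeLift ω hω (wedge R x y) = ω x y :=
  exteriorPower.alternatingMapLinearEquiv_apply_ιMulti _ _

theorem smul_exteriorSquare_eq_zero {c : R} (hc : ∀ x : M, c • x = 0) (w : ⋀[R]^2 M) :
    c • w = 0 := by
  have hw : w ∈ Submodule.span R (Set.range fun x : M × M => wedge R x.1 x.2) :=
    (span_range_wedge (R := R) (M := M)).ge Submodule.mem_top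
  induction hw using Submodule.span_induction with
  | mem w hw =>
    obtain ⟨x, rfl⟩ := hw
    rw [← LinearMap.smul_apply, ← map_smul, hc, map_zero, LinearMap.zero_apply]
  | zero => exact smul_zero c
  | add v w _ _ hv hw => rw [smul_add, hv, hw, add_zero]
  | smul a w _ hw => rw [smul_comm, hw, smul_zero]

instance finite_exteriorSquare {B : Type*} [AddCommGroup B] [Finite B] : Finite (⋀[ℤ]^2 B) := by
  have : Module.Finite ℤ B := .of_finite
  have hB (x : B) : (Nat.card B : ℤ) • x = 0 := by rw [natCast_zsmul, card_nsmul_eq_zero']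
  refine Module.finite_of_fg_torsion _ fun {w} => ⟨⟨Nat.card B, ?_⟩, ?_⟩
  · exact mem_nonZeroDivisors_of_ne_zero (mod_cast Nat.card_pos.ne')
  · exact smul_exteriorSquare_eq_zero hB w

end ExteriorSquare

section AlternatingForms

variable {R M N : Type*} [CommRing R] [AddCommGroup M] [Module R M] [AddCommGroup N] [Module R N]
  {ω : M →ₗ[R] M →ₗ[R] N}

theorem apply_smul_smul_of_isAlt (hω : ω.IsAlt) (g : M) (a b : R) : ω (a • g) (b • g) = 0 := by
  simp only [map_smul, LinearMap.smul_apply, hω g, smul_zero]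

-- Only the terms with `i < j` of `ω = ∑ ω (P i ·) (P j ·)` are kept in `β`.
theorem exists_sub_flip_eq_of_sum_eq_one {ι : Type*} [Fintype ι] (P : ι → Module.End R M)
    (hP : ∑ i, P i = 1) (hω : ω.IsAlt) (hωP : ∀ i x y, ω (P i x) (P i y) = 0) :
    ∃ β : M →ₗ[R] M →ₗ[R] N, β - β.flip = ω := by
  classical
  let _ : LinearOrder ι := LinearOrder.lift' (Fintype.equivFin ι) (Fintype.equivFin ι).injective
  refine ⟨∑ i, ∑ j, if i < j then ω.compl₁₂ (P i) (P j) else 0, LinearMap.ext₂ fun x y => ?_⟩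
  have sum_P (z : M) : ∑ i, P i z = z := by simpa using LinearMap.congr_fun hP z
  have expand : ω x y = ∑ i, ∑ j, ω (P i x) (P j y) := by
    conv_lhs => rw [← sum_P x, ← sum_P y]
    simp only [map_sum, LinearMap.sum_apply]
    exact Finset.sum_comm
  have apply_β (x y : M) : (∑ i, ∑ j, if i < j then ω.compl₁₂ (P i) (P j) else 0) x y =
      ∑ i, ∑ j, if i < j then ω (P i x) (P j y) else 0 := by
    simp only [LinearMap.sum_apply, apply_ite (fun f : M →ₗ[R] M →ₗ[R] N => f x y),
      LinearMap.compl₁₂_apply, LinearMap.zero_apply]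
  rw [LinearMap.sub_apply, LinearMap.sub_apply, LinearMap.flip_apply, apply_β, apply_β, expand,
    Finset.sum_comm (f := fun i j => if i < j then ω (P i y) (P j x) else 0)]
  simp only [← Finset.sum_sub_distrib]
  refine Finset.sum_congr rfl fun i _ => Finset.sum_congr rfl fun j _ => ?_
  rcases lt_trichotomy i j with hij | rfl | hij
  · simp [hij, hij.not_gt]
  · simp [hωP]
  · simp [hij, hij.not_gt, hω.neg]

theorem exists_sub_flip_eq_of_finite {B C : Type*} [AddCommGroup B] [Finite B] [AddCommGroup C]
    {ω : B →ₗ[ℤ] B →ₗ[ℤ] C} (hω : ω.IsAlt) : ∃ β : B →ₗ[ℤ] B →ₗ[ℤ] C, β - β.flip = ω := by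
  classical
  obtain ⟨ι, _, n, -, ⟨e⟩⟩ := AddCommGroup.equiv_directSum_zmod_of_finite' B
  let ε (i : ι) : ZMod (n i) →+ B := e.symm.toAddMonoidHom.comp (DirectSum.of (ZMod <| n ·) i)
  let P (i : ι) : Module.End ℤ B := (AddMonoidHom.mk' (fun x => ε i (e x i)) fun x y => by
    simp).toIntLinearMap
  have P_apply (i : ι) (x : B) : P i x = (e x i).cast (R := ℤ) • ε i 1 := by
    rw [← map_zsmul, zsmul_one, ZMod.intCast_zmod_cast]
    rfl
  have sum_P : ∑ i, P i = 1 := by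
    ext x
    rw [LinearMap.sum_apply, Module.End.one_apply]
    exact (map_sum e.symm _ _).symm.trans (by rw [DirectSum.sum_univ_of, e.symm_apply_apply])
  exact exists_sub_flip_eq_of_sum_eq_one P sum_P hω fun i x y => by
    rw [P_apply, P_apply, apply_smul_smul_of_isAlt hω]

end AlternatingForms

section BilinearExtension

/-- The central extension of `B` by `C` with bilinear cocycle `β`, so that
`(c, x) * (d, y) = (c + d + β x y, x + y)`. -/
@[ext]
structure BilinearExtension {B C : Type*} [AddCommGroup B] [AddCommGroup C]
    (β : B →ₗ[ℤ] B →ₗ[ℤ] C) where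
  fiber : C
  base : B

namespace BilinearExtension

variable {B C : Type*} [AddCommGroup B] [AddCommGroup C] {β : B →ₗ[ℤ] B →ₗ[ℤ] C}

instance : Mul (BilinearExtension β) :=
  ⟨fun g h => ⟨g.fiber + h.fiber + β g.base h.base, g.base + h.base⟩⟩

instance : One (BilinearExtension β) := ⟨⟨0, 0⟩⟩

instance : Inv (BilinearExtension β) := ⟨fun g => ⟨-g.fiber + β g.base g.base, -g.base⟩⟩

@[simp]
theorem fiber_mul (g h : BilinearExtension β) :
    (g * h).fiber = g.fiber + h.fiber + β g.base h.base := rfl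

@[simp]
theorem base_mul (g h : BilinearExtension β) : (g * h).base = g.base + h.base := rfl

@[simp]
theorem fiber_one : (1 : BilinearExtension β).fiber = 0 := rfl

@[simp]
theorem base_one : (1 : BilinearExtension β).base = 0 := rfl

@[simp]
theorem fiber_inv (g : BilinearExtension β) : g⁻¹.fiber = -g.fiber + β g.base g.base := rfl

@[simp]
theorem base_inv (g : BilinearExtension β) : g⁻¹.base = -g.base := rfl

instance : Group (BilinearExtension β) :=
  Group.ofLeftAxioms
    (fun a b c => by
      ext
      · simp only [fiber_mul, base_mul, map_add, LinearMap.add_apply]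
        abel
      · exact add_assoc ..)
    (fun a => by ext <;> simp)
    (fun a => by ext <;> simp)

variable (β) in
/-- The set-theoretic decomposition of the extension into its two coordinates. -/
def equivProd : BilinearExtension β ≃ C × B where
  toFun g := (g.fiber, g.base)
  invFun x := ⟨x.1, x.2⟩

variable (β) in
/-- The inclusion of the kernel of the extension. -/
def incl : Multiplicative C →* BilinearExtension β where
  toFun c := ⟨c.toAdd, 0⟩
  map_one' := rfl
  map_mul' c d := by ext <;> simp

theorem incl_ofAdd_fiber {g : BilinearExtension β} (hg : g.base = 0) :
    incl β (.ofAdd g.fiber) = g :=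
  BilinearExtension.ext rfl hg.symm

theorem mem_center_of_base_eq_zero {g : BilinearExtension β} (hg : g.base = 0) :
    g ∈ Subgroup.center (BilinearExtension β) :=
  Subgroup.mem_center_iff.2 fun h => by ext <;> simp [hg, add_comm]

theorem commutatorElement_eq_incl (g h : BilinearExtension β) :
    ⁅g, h⁆ = incl β (.ofAdd ((β - β.flip) g.base h.base)) := by
  rw [commutatorElement_def]
  ext
  · simp only [fiber_mul, base_mul, fiber_inv, base_inv, map_neg, map_add, LinearMap.neg_apply,
      LinearMap.add_apply]
    change _ = β g.base h.base - β h.base g.base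
    abel
  · change g.base + h.base + -g.base + -h.base = 0
    abel

theorem incl_mem_commutator {c : C}
    (hc : c ∈ Submodule.span ℤ (Set.range fun x : B × B => (β - β.flip) x.1 x.2)) :
    incl β (.ofAdd c) ∈ commutator (BilinearExtension β) := by
  induction hc using Submodule.span_induction with
  | mem c hc =>
    obtain ⟨x, rfl⟩ := hc
    rw [← commutatorElement_eq_incl ⟨0, x.1⟩ ⟨0, x.2⟩]
    exact Subgroup.commutator_mem_commutator (Subgroup.mem_top _) (Subgroup.mem_top _)
  | zero => exact one_mem _
  | add c d _ _ hc hd => exact ofAdd_add c d ▸ map_mul (incl β) _ _ ▸ mul_mem hc hd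
  | smul n c _ hc => exact ofAdd_zsmul n c ▸ map_zpow (incl β) _ n ▸ zpow_mem hc n

/-- The projection of the extension onto its quotient, written multiplicatively. -/
def proj {A : Type*} [CommGroup A] (β : Additive A →ₗ[ℤ] Additive A →ₗ[ℤ] C) :
    BilinearExtension β →* A where
  toFun g := g.base.toMul
  map_one' := rfl
  map_mul' _ _ := rfl

theorem isStemExtension_proj {A C : Type u} [CommGroup A] [AddCommGroup C]
    {β : Additive A →ₗ[ℤ] Additive A →ₗ[ℤ] C}
    (hβ : Submodule.span ℤ
      (Set.range fun x : Additive A × Additive A => (β - β.flip) x.1 x.2) = ⊤) :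
    IsStemExtension (proj β) where
  surjective a := ⟨⟨0, .ofMul a⟩, rfl⟩
  ker_le_center _ hg := mem_center_of_base_eq_zero hg
  ker_le_commutator _ hg := incl_ofAdd_fiber (β := β) hg ▸
    incl_mem_commutator (hβ.ge Submodule.mem_top)

end BilinearExtension

end BilinearExtension

section CommutatorPairing

variable {A E : Type*} [CommGroup A] [Group E]

theorem commutatorElement_mul_left_of_le_center (hE : commutator E ≤ Subgroup.center E)
    (a b c : E) : ⁅a * b, c⁆ = ⁅a, c⁆ * ⁅b, c⁆ := by
  have hbc : ⁅b, c⁆ ∈ Subgroup.center E :=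
    hE (Subgroup.commutator_mem_commutator (Subgroup.mem_top b) (Subgroup.mem_top c))
  rw [commutatorElement_mul_left_eq_conj_mul, Subgroup.mem_center_iff.1 hbc a,
    mul_inv_cancel_right, Subgroup.mem_center_iff.1 hbc]

theorem commutatorElement_mul_right_of_le_center (hE : commutator E ≤ Subgroup.center E)
    (a b c : E) : ⁅a, b * c⁆ = ⁅a, b⁆ * ⁅a, c⁆ := by
  have hac : ⁅a, c⁆ ∈ Subgroup.center E :=
    hE (Subgroup.commutator_mem_commutator (Subgroup.mem_top a) (Subgroup.mem_top c))
  rw [commutatorElement_mul_right_eq_mul_conj, mul_assoc ⁅a, b⁆, Subgroup.mem_center_iff.1 hac b,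
    mul_assoc, mul_inv_cancel_right]

/-- The commutator of a group of nilpotency class at most two, as a bimultiplicative map. -/
def commutatorHom (hE : commutator E ≤ Subgroup.center E) : E →* E →* Subgroup.center E :=
  MonoidHom.mk' (fun a => MonoidHom.mk' (fun b => ⟨⁅a, b⁆,
      hE (Subgroup.commutator_mem_commutator (Subgroup.mem_top a) (Subgroup.mem_top b))⟩)
    fun b c => Subtype.ext (commutatorElement_mul_right_of_le_center hE a b c))
  fun a b => MonoidHom.ext fun c => Subtype.ext (commutatorElement_mul_left_of_le_center hE a b c)

theorem exists_lift_of_surjective {G H K : Type*} [Group G] [Group H] [Group K] {π : G →* H}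
    (hπ : Function.Surjective π) (f : G →* K) (hf : π.ker ≤ f.ker) :
    ∃ g : H →* K, ∀ a, g (π a) = f a :=
  ⟨_, π.liftOfRightInverse_comp_apply _ (Function.rightInverse_surjInv hπ) ⟨f, hf⟩⟩

theorem exists_lift_pairing_of_surjective {G H C : Type*} [Group G] [Group H] [CommGroup C]
    {π : G →* H} (hπ : Function.Surjective π) (f : G →* G →* C) (hl : π.ker ≤ f.ker)
    (hr : π.ker ≤ f.flip.ker) : ∃ g : H →* H →* C, ∀ a b, g (π a) (π b) = f a b := by
  obtain ⟨f₁, hf₁⟩ := exists_lift_of_surjective hπ f hl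
  have hr₁ : π.ker ≤ f₁.flip.ker := fun b hb => MonoidHom.ext fun x => by
    obtain ⟨a, rfl⟩ := hπ x
    exact (DFunLike.congr_fun (hf₁ a) b).trans (DFunLike.congr_fun (hr hb) a)
  obtain ⟨f₂, hf₂⟩ := exists_lift_of_surjective hπ f₁.flip hr₁
  exact ⟨f₂.flip, fun a b =>
    (DFunLike.congr_fun (hf₂ b) (π a)).trans (DFunLike.congr_fun (hf₁ a) b)⟩

theorem exists_wedge_hom_eq_commutatorElement {π : E →* A} (hπ : Function.Surjective π)
    (hker : π.ker ≤ Subgroup.center E) :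
    ∃ φ : Multiplicative (⋀[ℤ]^2 (Additive A)) →* E,
      ∀ a b, φ (.ofAdd (wedge ℤ (.ofMul (π a)) (.ofMul (π b)))) = ⁅a, b⁆ := by
  have hE : commutator E ≤ Subgroup.center E := (Abelianization.commutator_subset_ker π).trans hker
  obtain ⟨c, hc⟩ := exists_lift_pairing_of_surjective hπ (commutatorHom hE)
    (fun a ha => MonoidHom.ext fun b => Subtype.ext <|
      commutatorElement_eq_one_iff_mul_comm.2 (Subgroup.mem_center_iff.1 (hker ha) b).symm)
    (fun b hb => MonoidHom.ext fun a => Subtype.ext <|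
      commutatorElement_eq_one_iff_mul_comm.2 (Subgroup.mem_center_iff.1 (hker hb) a))
  let ω : Additive A →ₗ[ℤ] Additive A →ₗ[ℤ] Additive (Subgroup.center E) :=
    LinearMap.mk₂ ℤ (fun x y => .ofMul (c x.toMul y.toMul))
      (fun x x' y => by simp) (fun n x y => by simp) (fun x y y' => by simp) (fun n x y => by simp)
  have hω : ω.IsAlt := fun x => by
    obtain ⟨a, ha⟩ := hπ x.toMul
    change Additive.ofMul (c x.toMul x.toMul) = 0
    rw [← ha, hc]
    exact congrArg Additive.ofMul (Subtype.ext (commutatorElement_self a))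
  refine ⟨(Subgroup.center E).subtype.comp
    (AddMonoidHom.toMultiplicativeLeft (wedgeLift ω hω).toAddMonoidHom), fun a b => ?_⟩
  change ((wedgeLift ω hω (wedge ℤ (.ofMul (π a)) (.ofMul (π b)))).toMul : E) = _
  rw [wedgeLift_wedge]
  exact congrArg Subtype.val (hc a b)

end CommutatorPairing

section SchurCover

variable {A E : Type u} [CommGroup A] [Group E] {π : E →* A}

namespace IsStemExtension

theorem card_eq (hπ : IsStemExtension π) : Nat.card E = Nat.card A * Nat.card π.ker := by
  rw [← π.ker.index_mul_card, Subgroup.index_ker, MonoidHom.range_eq_top.2 hπ.surjective,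
    Subgroup.card_top]

theorem exists_wedge_hom (hπ : IsStemExtension π) :
    ∃ φ : Multiplicative (⋀[ℤ]^2 (Additive A)) →* E,
      (∀ a b, φ (.ofAdd (wedge ℤ (.ofMul (π a)) (.ofMul (π b)))) = ⁅a, b⁆) ∧
        π.ker ≤ φ.range := by
  obtain ⟨φ, hφ⟩ := exists_wedge_hom_eq_commutatorElement hπ.surjective hπ.ker_le_center
  exact ⟨φ, hφ, hπ.ker_le_commutator.trans (Subgroup.commutator_le.2 fun a _ b _ => ⟨_, hφ a b⟩)⟩

variable [Finite A]

theorem card_le (hπ : IsStemExtension π) :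
    Nat.card E ≤ Nat.card A * Nat.card (⋀[ℤ]^2 (Additive A)) := by
  obtain ⟨φ, -, hφ⟩ := hπ.exists_wedge_hom
  have : Finite φ.range := .of_surjective _ φ.rangeRestrict_surjective
  calc Nat.card E = Nat.card A * Nat.card π.ker := hπ.card_eq
    _ ≤ Nat.card A * Nat.card φ.range := Nat.mul_le_mul_left _ (Subgroup.card_le_of_le hφ)
    _ ≤ Nat.card A * Nat.card (⋀[ℤ]^2 (Additive A)) :=
      Nat.mul_le_mul_left _ (Nat.card_le_card_of_surjective _ φ.rangeRestrict_surjective)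

end IsStemExtension

variable (A) in
theorem exists_isStemExtension_card_eq [Finite A] :
    ∃ (E : Type u) (_ : Group E) (_ : Finite E) (π : E →* A), IsStemExtension π ∧
      Nat.card E = Nat.card A * Nat.card (⋀[ℤ]^2 (Additive A)) := by
  obtain ⟨β, hβ⟩ := exists_sub_flip_eq_of_finite (wedge_isAlt (R := ℤ) (M := Additive A))
  refine ⟨BilinearExtension β, inferInstance, .of_equiv _ (BilinearExtension.equivProd β).symm,
    BilinearExtension.proj β, BilinearExtension.isStemExtension_proj (hβ ▸ span_range_wedge), ?_⟩
  rw [Nat.card_congr (BilinearExtension.equivProd β), Nat.card_prod, mul_comm]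
  rfl

variable (A) in
theorem exists_isSchurCover [Finite A] :
    ∃ (E : Type u) (_ : Group E) (π : E →* A), IsSchurCover π := by
  obtain ⟨E, _, hE, π, hπ, card_E⟩ := exists_isStemExtension_card_eq A
  exact ⟨E, _, π, hπ, hE, fun F _ _ ρ hρ => card_E ▸ hρ.card_le⟩

namespace IsSchurCover

variable [Finite A]

theorem card_exteriorSquare_le_card_ker (hπ : IsSchurCover π) :
    Nat.card (⋀[ℤ]^2 (Additive A)) ≤ Nat.card π.ker := by
  obtain ⟨F, _, _, ρ, hρ, card_F⟩ := exists_isStemExtension_card_eq A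
  refine Nat.le_of_mul_le_mul_left ?_ (Nat.card_pos (α := A))
  rw [← card_F, ← hπ.stem.card_eq]
  exact hπ.maximal F ρ hρ

theorem commute_iff_wedge_eq_zero (hπ : IsSchurCover π) (a b : E) :
    Commute a b ↔ wedge ℤ (Additive.ofMul (π a)) (Additive.ofMul (π b)) = 0 := by
  obtain ⟨φ, hφ, ker_le⟩ := hπ.stem.exists_wedge_hom
  have := hπ.finite
  have hinj : Function.Injective φ := MonoidHom.rangeRestrict_injective_iff.1
    (φ.rangeRestrict_surjective.bijective_of_nat_card_le
      (hπ.card_exteriorSquare_le_card_ker.trans (Subgroup.card_le_of_le ker_le))).injective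
  rw [← commutatorElement_eq_one_iff_commute, ← hφ, map_eq_one_iff φ hinj, ofAdd_eq_one]

theorem deepCommutingGraph_adj_iff (hπ : IsSchurCover π) (x y : A) :
    (deepCommutingGraph π).Adj x y ↔
      x ≠ y ∧ wedge ℤ (Additive.ofMul x) (Additive.ofMul y) = 0 := by
  obtain ⟨a, rfl⟩ := hπ.stem.surjective x
  obtain ⟨b, rfl⟩ := hπ.stem.surjective y
  refine and_congr_right fun _ => ?_
  rw [← hπ.commute_iff_wedge_eq_zero]
  refine ⟨fun h => h a b rfl rfl, fun h a' b' ha hb => ?_⟩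
  rwa [hπ.commute_iff_wedge_eq_zero, ha, hb, ← hπ.commute_iff_wedge_eq_zero]

end IsSchurCover

end SchurCover

section LinearDependence

variable {K V : Type*} [Field K] [AddCommGroup V] [Module K V] {x y : V}

theorem wedge_ne_zero_of_linearIndependent (h : LinearIndependent K ![x, y]) :
    wedge K x y ≠ 0 := by
  have hne := (exteriorPower.ιMulti_family_linearIndependent_field 2 h).ne_zero
    (Set.powersetCard.ofFinEmbEquiv (RelEmbedding.refl (· ≤ ·)))
  rwa [exteriorPower.ιMulti_family, Equiv.symm_apply_apply] at hne

theorem exists_smul_eq_of_wedge_eq_zero (hx : x ≠ 0) (h : wedge K x y = 0) :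
    ∃ c : K, c • x = y := by
  by_contra! hxy
  exact wedge_ne_zero_of_linearIndependent ((LinearIndependent.pair_iff' hx).2 hxy) h

theorem wedge_eq_zero_of_wedge_int_eq_zero (h : wedge ℤ x y = 0) : wedge K x y = 0 := by
  have hω : ((wedge K : V →ₗ[K] V →ₗ[K] ⋀[K]^2 V).restrictScalars₁₂ ℤ ℤ).IsAlt := wedge_isAlt
  have hlift := wedgeLift_wedge _ hω x y
  rw [h, map_zero] at hlift
  exact hlift.symm

end LinearDependence

section CyclicGroups

theorem isCyclic_closure_pair_iff {G : Type*} [Group G] {x y : G} :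
    IsCyclic (Subgroup.closure {x, y}) ↔
      ∃ g, x ∈ Subgroup.zpowers g ∧ y ∈ Subgroup.zpowers g := by
  constructor
  · intro h
    obtain ⟨g, hg⟩ := (Subgroup.isCyclic_iff_exists_zpowers_eq_top _).1 h
    exact ⟨g, hg ▸ Subgroup.subset_closure (Set.mem_insert x {y}),
      hg ▸ Subgroup.subset_closure (Set.mem_insert_of_mem x rfl)⟩
  · rintro ⟨g, hx, hy⟩
    exact Subgroup.isCyclic_of_le ((Subgroup.closure_le _).2 (Set.pair_subset hx hy))

theorem mem_zpowers_of_pow_orderOf_eq_one {G : Type*} [CommGroup G] [IsCyclic G] [Finite G]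
    {u v : G} (hv : v ^ orderOf u = 1) : v ∈ Subgroup.zpowers u := by
  have hle : Subgroup.zpowers u ≤ (powMonoidHom (orderOf u)).ker :=
    Subgroup.zpowers_le.2 (pow_orderOf_eq_one u)
  have hcard :
      Nat.card (powMonoidHom (α := G) (orderOf u)).ker = Nat.card (Subgroup.zpowers u) := by
    rw [IsCyclic.card_powMonoidHom_ker, Nat.gcd_eq_right (orderOf_dvd_natCard u), Nat.card_zpowers]
  exact (Subgroup.eq_of_le_of_card_ge hle hcard.le).ge hv

theorem mem_zpowers_of_isCyclic_closure_pair {G : Type*} [CommGroup G] [Finite G] {u v : G}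
    (h : IsCyclic (Subgroup.closure {u, v})) (hv : v ^ orderOf u = 1) :
    v ∈ Subgroup.zpowers u := by
  let u' : Subgroup.closure {u, v} := ⟨u, Subgroup.subset_closure (Set.mem_insert u {v})⟩
  let v' : Subgroup.closure {u, v} := ⟨v, Subgroup.subset_closure (Set.mem_insert_of_mem u rfl)⟩
  have hv' : v' ^ orderOf u' = 1 := Subtype.ext (Subgroup.orderOf_mk u u'.2 ▸ hv)
  obtain ⟨n, hn⟩ := mem_zpowers_of_pow_orderOf_eq_one hv'
  exact ⟨n, congrArg Subtype.val hn⟩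

theorem card_comap_le_card_ker_mul_card {G H : Type*} [Group G] [Group H] (f : G →* H)
    (K : Subgroup H) [Finite K] :
    Nat.card (K.comap f) ≤ Nat.card f.ker * Nat.card K := by
  have hker : f.ker ≤ K.comap f := Subgroup.ker_le_comap f K
  calc Nat.card (K.comap f) = Nat.card f.ker * Nat.card ((K.comap f).map f) := by
        rw [← Subgroup.relIndex_bot_left (K.comap f),
          ← Subgroup.relIndex_mul_relIndex ⊥ _ _ bot_le hker, Subgroup.relIndex_bot_left,
          Subgroup.relIndex_ker]
    _ ≤ Nat.card f.ker * Nat.card K :=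
        Nat.mul_le_mul_left _ (Subgroup.card_le_of_le (Subgroup.map_comap_le f K))

variable {A : Type*} [CommGroup A]

/-- Raising to the power of the index, as a homomorphism of a commutative group into a subgroup.
For a Sylow subgroup of a finite group it is, up to an automorphism of that subgroup, the
projection onto it. -/
noncomputable def powIndexHom (P : Subgroup A) : A →* P :=
  (powMonoidHom P.index).codRestrict P P.pow_index_mem

variable [Finite A]

theorem card_ker_powMonoidHom_pow_le {n : ℕ} (h : Nat.card (powMonoidHom (α := A) n).ker ≤ n)
    (k : ℕ) : Nat.card (powMonoidHom (α := A) (n ^ k)).ker ≤ n ^ k := by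
  induction k with
  | zero =>
    rw [pow_zero, (MonoidHom.ker_eq_bot_iff _).2 fun x y hxy => by simpa using hxy,
      Subgroup.card_bot]
  | succ k ih =>
    have hcomap : (powMonoidHom (α := A) (n ^ (k + 1))).ker =
        (powMonoidHom n).ker.comap (powMonoidHom (n ^ k)) := by
      ext x
      simp only [Subgroup.mem_comap, MonoidHom.mem_ker, powMonoidHom_apply, pow_succ, pow_mul]
    rw [hcomap, pow_succ]
    exact (card_comap_le_card_ker_mul_card _ _).trans (Nat.mul_le_mul ih h)

theorem isCyclic_of_card_ker_powMonoidHom_le {p : ℕ} (hp : p.Prime) (hA : IsPGroup p A)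
    (h : Nat.card (powMonoidHom (α := A) p).ker ≤ p) : IsCyclic A := by
  have := Fact.mk hp
  obtain ⟨k, hk⟩ := hA.exists_exponent_eq_pow
  have ker_eq_top : (powMonoidHom (α := A) (p ^ k)).ker = ⊤ :=
    eq_top_iff.2 fun x _ => hk ▸ Monoid.pow_exponent_eq_one x
  refine .of_exponent_eq_card <|
    (Nat.le_of_dvd Nat.card_pos Group.exponent_dvd_nat_card).antisymm ?_
  calc Nat.card A = Nat.card (powMonoidHom (α := A) (p ^ k)).ker := by
        rw [ker_eq_top, Subgroup.card_top]
    _ ≤ p ^ k := card_ker_powMonoidHom_pow_le h k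
    _ = Monoid.exponent A := hk.symm

theorem injOn_powIndexHom {p : ℕ} [Fact p.Prime] (P : Sylow p A) {Q : Subgroup A}
    (hQ : IsPGroup p Q) : Set.InjOn (powIndexHom (P : Subgroup A)) Q := fun a ha b hb hab => by
  have hpow : (⟨a, ha⟩ : Q) ^ P.index = (⟨b, hb⟩ : Q) ^ P.index :=
    Subtype.ext (show a ^ P.index = b ^ P.index from congrArg Subtype.val hab)
  exact congrArg Subtype.val ((hQ.powEquiv' P.not_dvd_index).injective hpow)

theorem isCyclic_of_forall_sylow (H : Subgroup A)
    (h : ∀ p, p.Prime → ∀ P : Sylow p A, IsCyclic (H.map (powIndexHom (P : Subgroup A)))) :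
    IsCyclic H := by
  suffices IsZGroup H from inferInstance
  refine ⟨fun p hp Q => ?_⟩
  have := Fact.mk hp
  let P : Sylow p A := default
  have := h p hp P
  have hQ : IsPGroup p ((Q : Subgroup H).map H.subtype) := Q.isPGroup'.map _
  refine isCyclic_of_injective (((powIndexHom (P : Subgroup A)).subgroupMap H).comp
    (Q : Subgroup H).subtype) fun a b hab => Subtype.ext (Subtype.ext ?_)
  exact injOn_powIndexHom P hQ (Subgroup.mem_map_of_mem _ a.2) (Subgroup.mem_map_of_mem _ b.2)
    (congrArg Subtype.val hab)

theorem exists_pow_ne_one_and_pow_pow_eq_one {G : Type*} [Group G] {p : ℕ} (hG : IsPGroup p G)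
    {z : G} (hz : z ^ p ≠ 1) : ∃ w : G, w ^ p ≠ 1 ∧ (w ^ p) ^ p = 1 := by
  obtain ⟨k, hk⟩ := hG z
  induction k generalizing z with
  | zero => exact absurd (by rw [show z = 1 by simpa using hk, one_pow]) hz
  | succ k ih =>
    by_cases h : (z ^ p) ^ p = 1
    · exact ⟨z, hz, h⟩
    · exact ih h (by rw [← pow_mul, ← pow_succ', hk])

end CyclicGroups

section WedgeDetectsCyclic

/-- The exterior square of `A` detects the cyclic two-generated subgroups: `⟨x, y⟩` is cyclic
whenever `x ∧ y = 0` (the converse holds in every commutative group). -/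
def WedgeDetectsCyclic (A : Type*) [CommGroup A] : Prop :=
  ∀ x y : A, wedge ℤ (Additive.ofMul x) (Additive.ofMul y) = 0 →
    IsCyclic (Subgroup.closure {x, y})

theorem wedge_eq_zero_of_isCyclic_closure_pair {A : Type*} [CommGroup A] {x y : A}
    (h : IsCyclic (Subgroup.closure {x, y})) :
    wedge ℤ (Additive.ofMul x) (Additive.ofMul y) = 0 := by
  obtain ⟨g, ⟨m, rfl⟩, ⟨n, rfl⟩⟩ := isCyclic_closure_pair_iff.1 h
  exact apply_smul_smul_of_isAlt wedge_isAlt (Additive.ofMul g) m n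

theorem wedge_ofMul_map_eq_zero {A B : Type*} [CommGroup A] [CommGroup B] (f : A →* B) {x y : A}
    (h : wedge ℤ (Additive.ofMul x) (Additive.ofMul y) = 0) :
    wedge ℤ (Additive.ofMul (f x)) (Additive.ofMul (f y)) = 0 := by
  have hmap := map_wedge f.toAdditive.toIntLinearMap (.ofMul x) (.ofMul y)
  rw [h, map_zero] at hmap
  exact hmap.symm

theorem map_closure_pair {G H : Type*} [Group G] [Group H] (f : G →* H) (x y : G) :
    (Subgroup.closure {x, y}).map f = Subgroup.closure {f x, f y} := by
  rw [MonoidHom.map_closure, Set.image_pair]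

namespace WedgeDetectsCyclic

variable {A : Type*} [CommGroup A]

theorem of_injective {B : Type*} [CommGroup B] (hA : WedgeDetectsCyclic A) {f : B →* A}
    (hf : Function.Injective f) : WedgeDetectsCyclic B := fun x y h => by
  have : IsCyclic ((Subgroup.closure {x, y}).map f) :=
    map_closure_pair f x y ▸ hA _ _ (wedge_ofMul_map_eq_zero f h)
  exact (Subgroup.equivMapOfInjective (Subgroup.closure {x, y}) f hf).isCyclic.2 this

theorem of_isCyclic [IsCyclic A] : WedgeDetectsCyclic A := fun _ _ _ => inferInstance

theorem of_forall_pow_eq_one {p : ℕ} (hp : p.Prime) (hA : ∀ x : A, x ^ p = 1) :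
    WedgeDetectsCyclic A := fun x y h => by
  have := Fact.mk hp
  let _ : Module (ZMod p) (Additive A) := AddCommGroup.zmodModule (n := p) hA
  rw [isCyclic_closure_pair_iff]
  rcases eq_or_ne x 1 with rfl | hx
  · exact ⟨y, one_mem _, Subgroup.mem_zpowers y⟩
  obtain ⟨c, hc⟩ := exists_smul_eq_of_wedge_eq_zero (K := ZMod p)
    (x := Additive.ofMul x) (y := Additive.ofMul y) hx (wedge_eq_zero_of_wedge_int_eq_zero h)
  rw [← ZMod.intCast_zmod_cast c, Int.cast_smul_eq_zsmul] at hc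
  exact ⟨x, Subgroup.mem_zpowers x, c.cast, hc⟩

variable [Finite A]

theorem isCyclic_of_pow_ne_one {p : ℕ} (h : WedgeDetectsCyclic A) (hp : p.Prime)
    (hA : IsPGroup p A) {z : A} (hz : z ^ p ≠ 1) : IsCyclic A := by
  have := Fact.mk hp
  obtain ⟨w, hw, hwp⟩ := exists_pow_ne_one_and_pow_pow_eq_one hA hz
  have orderOf_w : orderOf (w ^ p) = p := orderOf_eq_prime hwp hw
  have ker_le : (powMonoidHom p).ker ≤ Subgroup.zpowers (w ^ p) := fun v (hv : v ^ p = 1) => by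
    have hwedge : wedge ℤ (Additive.ofMul (w ^ p)) (Additive.ofMul v) = 0 := by
      rw [ofMul_pow, map_nsmul, LinearMap.smul_apply, ← map_nsmul, ← ofMul_pow, hv, ofMul_one,
        map_zero]
    exact mem_zpowers_of_isCyclic_closure_pair (h _ _ hwedge) (orderOf_w.symm ▸ hv)
  refine isCyclic_of_card_ker_powMonoidHom_le hp hA ((Subgroup.card_le_of_le ker_le).trans ?_)
  rw [Nat.card_zpowers, orderOf_w]

end WedgeDetectsCyclic

theorem wedgeDetectsCyclic_iff_of_isPGroup {A : Type u} [CommGroup A] [Finite A] {p : ℕ}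
    (hp : p.Prime) (hA : IsPGroup p A) :
    WedgeDetectsCyclic A ↔ IsCyclic A ∨ IsElementaryAbelian p A := by
  constructor
  · intro h
    by_cases hpow : ∀ x : A, x ^ p = 1
    · exact .inr ⟨mul_comm, hpow⟩
    · obtain ⟨z, hz⟩ := not_forall.1 hpow
      exact .inl (h.isCyclic_of_pow_ne_one hp hA hz)
  · rintro (_ | hA)
    · exact .of_isCyclic
    · exact .of_forall_pow_eq_one hp hA.2

theorem wedgeDetectsCyclic_iff_forall_sylow {A : Type*} [CommGroup A] [Finite A] :
    WedgeDetectsCyclic A ↔ ∀ p, p.Prime → ∀ P : Sylow p A, WedgeDetectsCyclic P := by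
  refine ⟨fun h p _ P => h.of_injective (P : Subgroup A).subtype_injective, fun h x y hxy => ?_⟩
  refine isCyclic_of_forall_sylow _ fun p hp P => ?_
  rw [map_closure_pair]
  exact h p hp P _ _ (wedge_ofMul_map_eq_zero _ hxy)

theorem IsSchurCover.deepCommutingGraph_eq_iff {A E : Type u} [CommGroup A] [Finite A] [Group E]
    {π : E →* A} (hπ : IsSchurCover π) :
    deepCommutingGraph π = enhancedPowerGraph A ↔ WedgeDetectsCyclic A := by
  refine ⟨fun h x y hxy => ?_, fun h => ?_⟩
  · rcases eq_or_ne x y with rfl | hne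
    · exact isCyclic_closure_pair_iff.2 ⟨x, Subgroup.mem_zpowers x, Subgroup.mem_zpowers x⟩
    · have hadj : (enhancedPowerGraph A).Adj x y :=
        h ▸ (hπ.deepCommutingGraph_adj_iff x y).2 ⟨hne, hxy⟩
      exact hadj.2
  · ext x y
    rw [hπ.deepCommutingGraph_adj_iff]
    exact and_congr_right fun _ => ⟨h x y, wedge_eq_zero_of_isCyclic_closure_pair⟩

end WedgeDetectsCyclic

theorem mainTheorem6 (A : Type u) [CommGroup A] [Finite A] :
    (∃ (E : Type u) (_ : Group E) (π : E →* A), IsSchurCover π) ∧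
    ∀ (E : Type u) [Group E] (π : E →* A), IsSchurCover π →
      (∀ p : ℕ, p.Prime → IsPGroup p A → ¬ IsCyclic A →
        (deepCommutingGraph π = enhancedPowerGraph A ↔ IsElementaryAbelian p A)) ∧
      (deepCommutingGraph π = enhancedPowerGraph A ↔
        ∀ p : ℕ, p.Prime → ∀ P : Sylow p A, IsCyclic P ∨ IsElementaryAbelian p P) := by
  refine ⟨exists_isSchurCover A, fun E _ π hπ => ⟨fun p hp hA hc => ?_, ?_⟩⟩
  · rw [hπ.deepCommutingGraph_eq_iff, wedgeDetectsCyclic_iff_of_isPGroup hp hA, or_iff_right hc]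
  · rw [hπ.deepCommutingGraph_eq_iff, wedgeDetectsCyclic_iff_forall_sylow]
    exact forall₃_congr fun p hp P => wedgeDetectsCyclic_iff_of_isPGroup hp P.isPGroup'
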